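/- Let $k$ be an infinite field with algebraic closure $\overline{k}$, let $X$ be a smooth irreducible $k$-scheme of finite type, and let $L/k$ be a finite separable field extension of degree $d$. Assume that $X_L = X\times_k L$ is unirational over $L$, i.e. that for some $N\ge 0$ there is a dominant rational map $\mathbb{A}^N_L \dashrightarrow X_L$ over $L$. Assume also that $\dim X>0$ or $d=1$. Let $\operatorname{Sym}^d X = X^d/S_d$ be the quotient of the $d$-fold fibre power of $X$ over $k$ by permutation of the factors, formed as a locally ringed space; this is the usual scheme quotient whenever every $S_d$-orbit in $X^d$ lies in an affine open subset, in particular when $X$ is quasi-projective. A closed point $x\in X$ whose residue field $\kappa(x)$ is isomorphic to $L$ over $k$ determines the point of $\operatorname{Sym}^d X$ that is the image of the geometric point $(x_{\sigma_1},\dots,x_{\sigma_d})$ of $X^d$, where $\sigma_1,\dots,\sigma_d$ are the $k$-embeddings $\kappa(x)\to\overline{k}$ and $x_{\sigma}\in X(\overline{k})$ is the point $\operatorname{Spec}\overline{k}\xrightarrow{\sigma}\operatorname{Spec}\kappa(x)\to X$; that is, it represents the zero-cycle $x_{\sigma_1}+\dots+x_{\sigma_d}$. Then the set of points of $\operatorname{Sym}^d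 X$ obtained in this way from the closed points of $X$ with residue field $L$ is dense in $\operatorname{Sym}^d X$ for the Zariski topology. -/

import Mathlib

open CategoryTheory CategoryTheory.Limits AlgebraicGeometry

universe u

noncomputable section

namespace SymDensity

/-- A scheme `Y` over a field `K` is unirational over `K` if some affine space `𝔸ᴺ` over `K` admits
a dominant rational map to `Y` that is compatible with the structure morphisms to `Spec K`. -/
def IsUnirational {K : Type u} [Field K] {Y : Scheme.{u}} (g : Y ⟶ Spec (.of K)) : Prop :=
  ∃ (N : ℕ) (φ : 𝔸(ULift.{u} (Fin N); Spec (.of K)) ⤏ Y),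
    φ.IsDominant ∧
      φ.compHom g = Scheme.Hom.toRationalMap (𝔸(ULift.{u} (Fin N); Spec (.of K)) ↘ Spec (.of K))

variable {k : Type u} [Field k] {X : Scheme.{u}} (f : X ⟶ Spec (.of k))

/-- The `d`-fold fibre power `X ×ₖ ⋯ ×ₖ X`. -/
abbrev power (d : ℕ) : Scheme.{u} :=
  widePullback (Spec (.of k)) (fun _ : Fin d => X) (fun _ => f)

/-- The `k`-automorphism of `X ×ₖ ⋯ ×ₖ X` that permutes the factors; on points it is
`(x₁, …, x_d) ↦ (x_{τ 1}, …, x_{τ d})`. -/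
def permute {d : ℕ} (τ : Equiv.Perm (Fin d)) : power f d ⟶ power f d :=
  WidePullback.lift (WidePullback.base _) (fun i => WidePullback.π _ (τ i)) (fun _ => by simp)

/-- The morphism `∐_τ Xᵈ ⟶ Xᵈ` that is `permute f τ` on the copy with index `τ`. -/
def permuteAll (d : ℕ) :
    (∐ fun _ : Equiv.Perm (Fin d) => (power f d).toLocallyRingedSpace) ⟶
      (power f d).toLocallyRingedSpace :=
  Sigma.desc fun τ => (permute f τ).toLRSHom

/-- The morphism `∐_τ Xᵈ ⟶ Xᵈ` that is the identity on every copy. -/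
def foldAll (d : ℕ) :
    (∐ fun _ : Equiv.Perm (Fin d) => (power f d).toLocallyRingedSpace) ⟶
      (power f d).toLocallyRingedSpace :=
  Sigma.desc fun _ => 𝟙 _

/-- The symmetric power `Symᵈ X = Xᵈ / S_d`: the quotient of the `d`-fold fibre power over `k` by
the group of permutations of the factors. The quotient is formed in locally ringed spaces, where it
always exists: it is the topological quotient with the sheaf of invariant functions. Whenever the
quotient exists as a scheme in the usual sense (every orbit lies in an affine open subset, for
instance `X` quasi-projective), it is this locally ringed space. -/
def SymPower (d : ℕ) : LocallyRingedSpace.{u} :=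
  coequalizer (permuteAll f d) (foldAll f d)

/-- The quotient morphism `Xᵈ ⟶ Symᵈ X`. -/
def toSym (d : ℕ) : (power f d).toLocallyRingedSpace ⟶ SymPower f d :=
  coequalizer.π _ _

/-- The quotient morphism is invariant under the permutations of the factors. -/
theorem permute_toSym {d : ℕ} (τ : Equiv.Perm (Fin d)) :
    (permute f τ).toLRSHom ≫ toSym f d = toSym f d := by
  have h := Sigma.ι (fun _ : Equiv.Perm (Fin d) => (power f d).toLocallyRingedSpace) τ ≫=
    coequalizer.condition (permuteAll f d) (foldAll f d)
  rw [permuteAll, foldAll, Sigma.ι_desc_assoc, Sigma.ι_desc_assoc, Category.id_comp] at h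
  exact h

/-- The `k`-algebra structure of the residue field `κ(x)` of a point `x` of `X`. -/
abbrev residueAlgebra (x : X) : Algebra k (X.residueField x) :=
  (Spec.preimage (X.fromSpecResidueField x ≫ f)).hom.toAlgebra

/-- The `k`-embeddings of the residue field `κ(x)` into the algebraic closure of `k`. -/
abbrev Embeddings (x : X) : Type u :=
  letI := residueAlgebra f x
  X.residueField x →ₐ[k] AlgebraicClosure k

/-- The `k`-isomorphisms of the residue field `κ(x)` with an extension `L` of `k`. -/
abbrev ResidueIso (L : Type u) [Field L] [Algebra k L] (x : X) : Type u :=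
  letI := residueAlgebra f x
  X.residueField x ≃ₐ[k] L

/-- The geometric point of `X` that lies over `x` and belongs to the embedding `σ` of `κ(x)`. -/
def geomPoint (x : X) (σ : Embeddings f x) :
    Spec (.of (AlgebraicClosure k)) ⟶ X :=
  letI := residueAlgebra f x
  Spec.map (CommRingCat.ofHom σ.toRingHom) ≫ X.fromSpecResidueField x

/-- A geometric point `geomPoint f x σ` is a morphism over `k`. -/
theorem geomPoint_comp (x : X) (σ : Embeddings f x) :
    geomPoint f x σ ≫ f =
      Spec.map (CommRingCat.ofHom (algebraMap k (AlgebraicClosure k))) := by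
  let := residueAlgebra f x
  have h : X.fromSpecResidueField x ≫ f =
      Spec.map (CommRingCat.ofHom (algebraMap k (X.residueField x))) :=
    (Spec.map_preimage _).symm
  rw [geomPoint, Category.assoc, h, ← Spec.map_comp, ← CommRingCat.ofHom_comp]
  congr 2
  exact σ.comp_algebraMap

/-- For a listing `σ₁, …, σ_d` of the embeddings of `κ(x)`, the geometric point
`(x_{σ₁}, …, x_{σ_d})` of `Xᵈ`. -/
def conjugates {d : ℕ} (x : X) (e : Fin d ≃ Embeddings f x) :
    Spec (.of (AlgebraicClosure k)) ⟶ power f d :=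
  WidePullback.lift (Spec.map (CommRingCat.ofHom (algebraMap k (AlgebraicClosure k))))
    (fun i => geomPoint f x (e i)) (fun i => geomPoint_comp f x (e i))

/-- The geometric point of `Symᵈ X` given by the zero-cycle `x_{σ₁} + ⋯ + x_{σ_d}`, where
`σ₁, …, σ_d` are the embeddings of `κ(x)` into the algebraic closure of `k`. -/
def symGeomPoint {d : ℕ} (x : X) (e : Fin d ≃ Embeddings f x) :
    (Spec (.of (AlgebraicClosure k))).toLocallyRingedSpace ⟶ SymPower f d :=
  (conjugates f x e).toLRSHom ≫ toSym f d

/-- The geometric point of `Symᵈ X` does not depend on the order in which the embeddings are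
listed. -/
theorem symGeomPoint_eq {d : ℕ} (x : X) (e e' : Fin d ≃ Embeddings f x) :
    symGeomPoint f x e = symGeomPoint f x e' := by
  have h : conjugates f x e ≫ permute f (e'.trans e.symm) = conjugates f x e' := by
    apply WidePullback.hom_ext
    · intro i
      rw [Category.assoc, permute, WidePullback.lift_π, conjugates, conjugates,
        WidePullback.lift_π, WidePullback.lift_π]
      simp
    · rw [Category.assoc, permute, WidePullback.lift_base, conjugates, conjugates,
        WidePullback.lift_base, WidePullback.lift_base]
  rw [symGeomPoint, symGeomPoint, ← h, Scheme.Hom.comp_toLRSHom, Category.assoc, permute_toSym]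

/-- The unique point of `Spec` of the algebraic closure of `k`. -/
def specPoint (k : Type u) [Field k] :
    (Spec (.of (AlgebraicClosure k))).toLocallyRingedSpace :=
  IsLocalRing.closedPoint (AlgebraicClosure k)

/-- The point of `Symᵈ X` that underlies its geometric point `x_{σ₁} + ⋯ + x_{σ_d}`. -/
def symPoint {d : ℕ} (x : X) (e : Fin d ≃ Embeddings f x) : SymPower f d :=
  (symGeomPoint f x e).base (specPoint k)

/-- The set of closed points of `X` with residue field `L` (as an extension of `k`), viewed as a
subset of `Symᵈ X`. -/
def closedPointsWithResidueField (L : Type u) [Field L] [Algebra k L] (d : ℕ) : Set (SymPower f d) :=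
  {s | ∃ x : X, IsClosed ({x} : Set X) ∧ Nonempty (ResidueIso f L x) ∧
    ∃ e : Fin d ≃ Embeddings f x, s = symPoint f x e}

end SymDensity

end

/-! Since `toSym` is continuous and surjective, it suffices to find, in every nonempty open `W` of
Xᵈ, a tuple of conjugates of one L-valued point whose residue field is all of L. Let F be an
algebraically closed field over which `W` has a point, and let τ₁, …, τ_d be the embeddings of L
into F. Unirationality gives y : Spec L[t]_h → X whose induced map to X_L is dominant.

Dominance survives base change along τᵢ, because X_F → X_L is open. As F is infinite, the
coordinates of the tuple can be moved one after another, inside `W`, until the i-th is the value of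
the τᵢ-conjugate of y at some cᵢ ∈ Fⁿ (`exists_param_tuple_mem`). So a nonempty open set of
parameters (c₁, …, c_d) in F^{dn} gives tuples in `W`. By independence of characters the matrix (τᵢ
e_l), for a basis e of L over k, is invertible; hence the families (τ₁ a, …, τ_d a) with a ∈ Lⁿ are
the k-rational points of F^{dn} in other linear coordinates. They are dense because k is infinite,
so some a gives a conjugate tuple in `W` (`exists_conjugate_tuple_mem`).

The residue field at y(a) must not be a proper subfield of L. If dim X > 0, some regular function on
an affine open of X pulls back to a nonconstant r on the parameter space (`exists_nonconstant`).
That the τᵢ(r(a)) be pairwise different is one more open condition, which the cᵢ can be chosen to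
satisfy; it makes r(a) a primitive element of L, and r(a) comes from the residue field
(`exists_residueIso`). For d = 1 the condition is void. -/

noncomputable section

namespace SymDensity

open MvPolynomial

/-! ### Evaluation of fractions in L[t]_h at points -/

section EvalAway

variable {n L S T : Type*} [Field L] [CommRing S] [CommRing T]

/-- The ring homomorphism `L[t]_h → S` given by a homomorphism `τ` on the coefficients and by a
point `c` at which `h` becomes a unit. -/
def evalAway {h : MvPolynomial n L} (τ : L →+* S) (c : n → S) (hc : IsUnit (eval₂Hom τ c h)) :
    Localization.Away h →+* S :=
  IsLocalization.Away.lift h hc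

@[simp]
theorem evalAway_algebraMap {h : MvPolynomial n L} (τ : L →+* S) (c : n → S)
    (hc : IsUnit (eval₂Hom τ c h)) (p : MvPolynomial n L) :
    evalAway τ c hc (algebraMap _ _ p) = eval₂ τ c p :=
  IsLocalization.Away.lift_eq h hc p

theorem evalAway_algebraMap_coeff {h : MvPolynomial n L} (τ : L →+* S) (c : n → S)
    (hc : IsUnit (eval₂Hom τ c h)) (a : L) :
    evalAway τ c hc (algebraMap L _ a) = τ a := by
  rw [IsScalarTower.algebraMap_apply L (MvPolynomial n L) (Localization.Away h),
    evalAway_algebraMap, MvPolynomial.algebraMap_eq, eval₂_C]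

theorem evalAway_comp_algebraMap {h : MvPolynomial n L} (τ : L →+* S) (c : n → S)
    (hc : IsUnit (eval₂Hom τ c h)) :
    (evalAway τ c hc).comp (algebraMap L _) = τ :=
  RingHom.ext (evalAway_algebraMap_coeff τ c hc)

/-- Homomorphisms out of `L[t]_h` agree if they agree on `L` and on the variables. -/
theorem ringHom_away_ext {h : MvPolynomial n L} {φ ψ : Localization.Away h →+* S}
    (hC : ∀ a : L, φ (algebraMap L _ a) = ψ (algebraMap L _ a))
    (hX : ∀ i, φ (algebraMap (MvPolynomial n L) _ (X i)) =
      ψ (algebraMap (MvPolynomial n L) _ (X i))) : φ = ψ := by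
  refine IsLocalization.ringHom_ext (Submonoid.powers h) (MvPolynomial.ringHom_ext ?_ ?_)
  · intro a
    simpa [IsScalarTower.algebraMap_apply L (MvPolynomial n L) (Localization.Away h)] using hC a
  · intro i
    simpa using hX i

theorem evalAway_unique {h : MvPolynomial n L} (τ : L →+* S) (c : n → S)
    (hc : IsUnit (eval₂Hom τ c h)) (φ : Localization.Away h →+* S)
    (hC : ∀ a : L, φ (algebraMap L _ a) = τ a)
    (hX : ∀ i, φ (algebraMap (MvPolynomial n L) _ (X i)) = c i) : φ = evalAway τ c hc := by
  refine ringHom_away_ext (fun a => ?_) (fun i => ?_)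
  · rw [hC, evalAway_algebraMap_coeff]
  · rw [hX, evalAway_algebraMap, eval₂_X]

/-- Every element of `L[t]_h` is a fraction whose denominator is a power of `h`. -/
theorem exists_numerator {h : MvPolynomial n L} (s : Localization.Away h) :
    ∃ (p : MvPolynomial n L) (m : ℕ), s * algebraMap _ _ (h ^ m) = algebraMap _ _ p := by
  obtain ⟨⟨p, ⟨_, m, rfl⟩⟩, hp⟩ := IsLocalization.surj (Submonoid.powers h) s
  exact ⟨p, m, hp⟩

/-- Over an infinite field, a nonzero polynomial has a point at which it does not vanish. -/
theorem exists_eval_ne_zero {F : Type*} [Field F] [Infinite F] (p : MvPolynomial n F)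
    (hp : p ≠ 0) : ∃ c : n → F, eval c p ≠ 0 := by
  by_contra! hcon
  exact hp (MvPolynomial.funext fun c => by rw [hcon c, map_zero])

/-- Over an infinite field, a nonzero element of `F[t]_h` has a point of `F` at which it does not
vanish, and one may avoid the zeros of a further nonzero polynomial. -/
theorem exists_evalAway_ne_zero {F : Type*} [Field F] [Infinite F] {h : MvPolynomial n F}
    (hh : h ≠ 0) (s : Localization.Away h) (hs : s ≠ 0) (q : MvPolynomial n F) (hq : q ≠ 0) :
    ∃ (c : n → F) (hc : IsUnit (eval₂Hom (RingHom.id F) c h)),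
      evalAway (RingHom.id F) c hc s ≠ 0 ∧ eval c q ≠ 0 := by
  obtain ⟨p, m, hp⟩ := exists_numerator s
  have hp0 : p ≠ 0 := by
    rintro rfl
    rw [map_zero] at hp
    have hu : IsUnit (algebraMap (MvPolynomial n F) (Localization.Away h) (h ^ m)) := by
      rw [map_pow]
      exact (IsLocalization.Away.algebraMap_isUnit h).pow m
    exact hs (hu.mul_left_eq_zero.mp hp)
  -- Nonvanishing of `p` handles `s = p / h ^ m`, that of `h` makes the evaluation defined, and `q`
  -- is the extra condition.
  obtain ⟨c, hc⟩ := exists_eval_ne_zero (p * h * q) (mul_ne_zero (mul_ne_zero hp0 hh) hq)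
  rw [map_mul, map_mul] at hc
  have hc' : IsUnit (eval₂Hom (RingHom.id F) c h) :=
    (right_ne_zero_of_mul (left_ne_zero_of_mul hc)).isUnit
  refine ⟨c, hc', fun h0 => ?_, right_ne_zero_of_mul hc⟩
  have := congrArg (evalAway (RingHom.id F) c hc') hp
  rw [map_mul, h0, zero_mul, evalAway_algebraMap] at this
  exact left_ne_zero_of_mul (left_ne_zero_of_mul hc) this.symm

end EvalAway

/-- If `r ∈ L[t]_h` is not a constant, the values of `r` at points over an extension `F` avoid any
given constant off the zeros of a nonzero polynomial. -/
theorem exists_polynomial_avoiding {n L F : Type*} [Field L] [Field F] {h : MvPolynomial n L}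
    (hh : h ≠ 0) (τ : L →+* F) (r : Localization.Away h)
    (hr : r ∉ Set.range (algebraMap L (Localization.Away h))) (v : F) :
    ∃ q : MvPolynomial n F, q ≠ 0 ∧ ∀ (c : n → F) (hc : IsUnit (eval₂Hom τ c h)),
      eval c q ≠ 0 → evalAway τ c hc r ≠ v := by
  obtain ⟨p, m, hp⟩ := exists_numerator r
  -- With `r = p / h ^ m`, the value `v` is taken only at zeros of this polynomial. If it were zero,
  -- comparing coefficients at a monomial of `h ^ m` would put `v` in `τ L` and make `r` constant.
  refine ⟨MvPolynomial.map τ p - C v * MvPolynomial.map τ (h ^ m), fun h0 => hr ?_, ?_⟩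
  · rw [sub_eq_zero] at h0
    have hm : h ^ m ≠ 0 := pow_ne_zero m hh
    obtain ⟨μ, hμ⟩ := MvPolynomial.ne_zero_iff.mp hm
    have hcoef (ν) : τ (p.coeff ν) = v * τ ((h ^ m).coeff ν) := by
      rw [← coeff_map, h0, coeff_C_mul, coeff_map]
    have hv : v = τ (p.coeff μ / (h ^ m).coeff μ) := by
      rw [map_div₀, hcoef, mul_div_cancel_right₀]
      exact (map_ne_zero τ).mpr hμ
    refine ⟨p.coeff μ / (h ^ m).coeff μ, ?_⟩
    have hu : IsUnit (algebraMap (MvPolynomial n L) (Localization.Away h) (h ^ m)) := by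
      rw [map_pow]
      exact (IsLocalization.Away.algebraMap_isUnit h).pow m
    refine hu.mul_left_injective ?_
    dsimp only
    rw [hp, IsScalarTower.algebraMap_apply L (MvPolynomial n L), ← map_mul]
    congr 1
    ext ν
    apply τ.injective
    rw [hcoef, MvPolynomial.algebraMap_eq, coeff_C_mul, map_mul, ← hv]
  · intro c hc hq hrv
    apply hq
    have := congrArg (evalAway τ c hc) hp
    rw [map_mul, hrv, evalAway_algebraMap, evalAway_algebraMap] at this
    rw [map_sub, map_mul, eval_C, MvPolynomial.eval_map, MvPolynomial.eval_map, ← this, sub_self]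

/-! ### Zariski density of families of conjugates -/

section Conjugates

variable {k L F : Type*} [Field k] [Field L] [Field F] [Algebra k L] [Algebra k F]

/-- The matrix of conjugates of a basis is invertible: every family of elements of `F` is the
family of values of the embeddings on an `F`-combination of the basis. -/
theorem exists_combination_of_embeddings {d : ℕ} (e : Module.Basis (Fin d) k L)
    (τ : Fin d → L →ₐ[k] F) (hτ : Function.Injective τ) :
    ∃ N : Matrix (Fin d) (Fin d) F, (Matrix.of fun i l => τ i (e l)) * N = 1 := by
  let M : Matrix (Fin d) (Fin d) F := Matrix.of fun i l => τ i (e l)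
  -- A relation between the rows is a relation between the embeddings on a basis, hence on all of L;
  -- independence of characters excludes it.
  have hind : LinearIndependent F M.row := by
    rw [Fintype.linearIndependent_iff]
    intro g hg
    have hli : LinearIndependent F (fun i : Fin d => ((τ i : L →ₐ[k] F) : L → F)) := by
      have h1 := linearIndependent_monoidHom L F
      refine h1.comp (fun i => ((τ i : L →+* F) : L →* F)) ?_
      intro i j hij
      exact hτ (AlgHom.ext fun x => DFunLike.congr_fun hij x)
    rw [Fintype.linearIndependent_iff] at hli
    refine hli g (funext fun x => ?_)
    have hlin : (∑ i, g i • (τ i).toLinearMap : L →ₗ[k] F) = 0 := by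
      refine e.ext fun l => ?_
      have := congrFun hg l
      simpa [M, Finset.sum_apply] using this
    simpa [Finset.sum_apply] using LinearMap.congr_fun hlin x
  have hM : IsUnit M := Matrix.linearIndependent_rows_iff_isUnit.mp hind
  exact ⟨M⁻¹, Matrix.mul_nonsing_inv M ((Matrix.isUnit_iff_isUnit_det M).mp hM)⟩

/-- Over an infinite field `k`, the families of conjugates `(τᵢ aⱼ)` of tuples `a` of elements of
`L` are Zariski dense in affine space over `F`. -/
theorem exists_eval_conjugates_ne_zero {n : Type*} [Infinite k] {d : ℕ}
    (e : Module.Basis (Fin d) k L) (τ : Fin d → L →ₐ[k] F) (hτ : Function.Injective τ)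
    (Q : MvPolynomial (Fin d × n) F) (c : Fin d × n → F) (hc : eval c Q ≠ 0) :
    ∃ a : n → L, eval (fun ij => τ ij.1 (a ij.2)) Q ≠ 0 := by
  obtain ⟨N, hN⟩ := exists_combination_of_embeddings e τ hτ
  -- A linear change of coordinates: at a k-rational point `s` it gives the conjugates of `a j = ∑
  -- l, s (l, j) • e l`.
  let sub : Fin d × n → MvPolynomial (Fin d × n) F :=
    fun ij => ∑ l, C (τ ij.1 (e l)) * X (l, ij.2)
  have heval (s : Fin d × n → F) :
      eval s (bind₁ sub Q) = eval (fun ij => ∑ l, τ ij.1 (e l) * s (l, ij.2)) Q := by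
    refine (eval₂Hom_bind₁ (RingHom.id F) s sub Q).trans ?_
    congr 2
    funext ij
    simp [sub]
  -- The inverse matrix `N` supplies the point that the substitution sends to `c`.
  have hne : bind₁ sub Q ≠ 0 := by
    intro h0
    have h1 := heval (fun lj => ∑ i, N lj.1 i * c (i, lj.2))
    rw [h0, map_zero] at h1
    apply hc
    rw [h1]
    congr 2
    funext ⟨i, j⟩
    have h2 (i') : ∑ l, τ i (e l) * N l i' = if i = i' then 1 else 0 := by
      simpa [Matrix.mul_apply, Matrix.one_apply] using congrFun (congrFun hN i) i'
    simp only [Finset.mul_sum, ← mul_assoc]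
    rw [Finset.sum_comm]
    simp [← Finset.sum_mul, h2]
  obtain ⟨s, hs⟩ : ∃ s : Fin d × n → k,
      eval (fun x => algebraMap k F (s x)) (bind₁ sub Q) ≠ 0 := by
    by_contra! hcon
    refine hne (MvPolynomial.funext_set (fun _ => Set.range (algebraMap k F))
      (fun _ => Set.infinite_range_of_injective (algebraMap k F).injective) fun x hx => ?_)
    choose s hs using fun i => hx i (Set.mem_univ i)
    rw [← funext hs, hcon, map_zero]
  refine ⟨fun j => ∑ l, s (l, j) • e l, ?_⟩
  rw [heval] at hs
  convert hs using 5
  simp [Algebra.smul_def, mul_comm]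

end Conjugates

/-! ### Spectra of fields and field-valued points -/

/-- The morphism of spectra that belongs to a ring homomorphism. -/
abbrev specHom {R S : Type u} [CommRing R] [CommRing S] (φ : R →+* S) :
    Spec (.of S) ⟶ Spec (.of R) :=
  Spec.map (CommRingCat.ofHom φ)

theorem specHom_comp {R S T : Type u} [CommRing R] [CommRing S] [CommRing T] (φ : R →+* S)
    (ψ : S →+* T) : specHom (ψ.comp φ) = specHom ψ ≫ specHom φ := by
  rw [specHom, CommRingCat.ofHom_comp, Spec.map_comp]

theorem specHom_surjective {R S : Type u} [CommRing R] [CommRing S]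
    (g : Spec (.of S) ⟶ Spec (.of R)) : ∃ φ : R →+* S, g = specHom φ := by
  obtain ⟨φ, rfl⟩ := Spec.map_surjective g
  exact ⟨φ.hom, rfl⟩

theorem specHom_injective {R S : Type u} [CommRing R] [CommRing S] {φ ψ : R →+* S}
    (h : specHom φ = specHom ψ) : φ = ψ :=
  congrArg CommRingCat.Hom.hom (Spec.map_injective h)

theorem specHom_id {R : Type u} [CommRing R] : specHom (RingHom.id R) = 𝟙 _ :=
  Spec.map_id _

/-- The only point of the spectrum of a field. -/
def specPt (F : Type u) [Field F] : Spec (.of F) :=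
  IsLocalRing.closedPoint F

instance (F : Type u) [Field F] : Subsingleton (Spec (.of F)) :=
  inferInstanceAs (Subsingleton (PrimeSpectrum F))

/-- A point of the spectrum of a ring that comes from a field lies in a basic open set if and only
if the function does not vanish at it. -/
theorem specHom_specPt_mem_basicOpen {R F : Type u} [CommRing R] [Field F] (φ : R →+* F) (s : R) :
    (specHom φ) (specPt F) ∈ PrimeSpectrum.basicOpen s ↔ φ s ≠ 0 := by
  change ¬ (φ s ∈ IsLocalRing.maximalIdeal F) ↔ _
  rw [IsLocalRing.maximalIdeal_eq_bot, Ideal.mem_bot]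

theorem exists_basicOpen_of_isOpen {R F : Type u} [CommRing R] [Field F] (φ : R →+* F)
    (O : (Spec (.of R)).Opens) (h : (specHom φ) (specPt F) ∈ O) :
    ∃ s : R, φ s ≠ 0 ∧ PrimeSpectrum.basicOpen s ≤ O := by
  obtain ⟨_, ⟨s, rfl⟩, hs, hsO⟩ :=
    PrimeSpectrum.isTopologicalBasis_basic_opens.exists_subset_of_mem_open h O.2
  exact ⟨s, (specHom_specPt_mem_basicOpen φ s).mp hs, hsO⟩

/-- Every point of a scheme is the image of the spectrum of a field. -/
theorem exists_field_point {A : Scheme.{u}} (x : A) :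
    ∃ (K : Type u) (_ : Field K) (p : Spec (.of K) ⟶ A), p (specPt K) = x :=
  ⟨A.residueField x, inferInstance, A.fromSpecResidueField x,
    Scheme.fromSpecResidueField_apply _ _⟩

/-- Two points with the same image are the images of compatible morphisms from the spectrum of a
field. -/
theorem exists_common_field_point {A B C : Scheme.{u}} (f : A ⟶ C) (g : B ⟶ C) (x : A) (y : B)
    (h : f x = g y) :
    ∃ (K : Type u) (_ : Field K) (p : Spec (.of K) ⟶ A) (q : Spec (.of K) ⟶ B),
      p ≫ f = q ≫ g ∧ q (specPt K) = y := by
  obtain ⟨t, -, ht⟩ := Scheme.Pullback.exists_preimage_pullback (f := f) (g := g) x y h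
  obtain ⟨K, hK, T, hT⟩ := exists_field_point t
  refine ⟨K, hK, T ≫ pullback.fst f g, T ≫ pullback.snd f g, ?_, ?_⟩
  · rw [Category.assoc, Category.assoc, pullback.condition]
  · rw [Scheme.Hom.comp_apply, hT, ht]

/-! ### Base change of a dominant parametrization -/

section Coordinate

variable {k L F : Type u} [Field k] [Field L] [Field F] [Algebra k L] {X : Scheme.{u}}
  (f : X ⟶ Spec (.of k)) {n : Type u}

/-- The projection from the base change `X_F` to the base change `X_L`, for a homomorphism
`L → F`. -/
def baseChangeMap (τ : L →+* F) (κ : k →+* F) (hκ : τ.comp (algebraMap k L) = κ) :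
    pullback f (specHom κ) ⟶ pullback f (specHom (algebraMap k L)) :=
  pullback.lift (pullback.fst f (specHom κ)) (pullback.snd f (specHom κ) ≫ specHom τ)
    (by rw [pullback.condition, ← hκ, specHom_comp, Category.assoc])

theorem baseChangeMap_fst (τ : L →+* F) (κ : k →+* F) (hκ : τ.comp (algebraMap k L) = κ) :
    baseChangeMap f τ κ hκ ≫ pullback.fst _ _ = pullback.fst _ _ :=
  pullback.lift_fst _ _ _

theorem baseChangeMap_snd (τ : L →+* F) (κ : k →+* F) (hκ : τ.comp (algebraMap k L) = κ) :
    baseChangeMap f τ κ hκ ≫ pullback.snd _ _ = pullback.snd _ _ ≫ specHom τ :=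
  pullback.lift_snd _ _ _

/-- The base change of `X_L` to an extension of `L` is an open map. -/
theorem isOpenMap_baseChangeMap (τ : L →+* F) (κ : k →+* F) (hκ : τ.comp (algebraMap k L) = κ) :
    IsOpenMap (baseChangeMap f τ κ hκ) := by
  -- By pasting, X_F is the base change of X_L along Spec F → Spec L, which is universally open.
  have hsq : IsPullback (baseChangeMap f τ κ hκ) (pullback.snd f (specHom κ))
      (pullback.snd f (specHom (algebraMap k L))) (specHom τ) := by
    refine IsPullback.of_right ?_ (baseChangeMap_snd f τ κ hκ) (IsPullback.of_hasPullback f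
      (specHom (algebraMap k L)))
    rw [← specHom_comp, baseChangeMap_fst, hκ]
    exact IsPullback.of_hasPullback f (specHom κ)
  have : UniversallyOpen (baseChangeMap f τ κ hκ) :=
    MorphismProperty.of_isPullback hsq.flip (inferInstanceAs (UniversallyOpen (specHom τ)))
  exact (baseChangeMap f τ κ hκ).isOpenMap

/-- The homomorphism `L[t]_h → F[t]_h` for a homomorphism `τ : L → F`. -/
def awayMap (τ : L →+* F) (h : MvPolynomial n L) :
    Localization.Away h →+* Localization.Away (MvPolynomial.map τ h) :=
  evalAway ((algebraMap F _).comp τ)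
    (fun i => algebraMap (MvPolynomial n F) _ (MvPolynomial.X i)) (by
      have h1 : eval₂Hom ((algebraMap F (Localization.Away (MvPolynomial.map τ h))).comp τ)
          (fun i => algebraMap (MvPolynomial n F) _ (MvPolynomial.X i)) =
          (algebraMap (MvPolynomial n F) _).comp (MvPolynomial.map τ) := by
        refine MvPolynomial.ringHom_ext (fun a => ?_) (fun i => ?_)
        · simp [IsScalarTower.algebraMap_apply F (MvPolynomial n F)
            (Localization.Away (MvPolynomial.map τ h))]
        · simp
      rw [h1]
      exact IsLocalization.Away.algebraMap_isUnit (S := Localization.Away (MvPolynomial.map τ h))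
        (MvPolynomial.map τ h))

theorem awayMap_coeff (τ : L →+* F) (h : MvPolynomial n L) (a : L) :
    awayMap τ h (algebraMap L _ a) = algebraMap F _ (τ a) :=
  evalAway_algebraMap_coeff _ _ _ a

theorem awayMap_comp (τ : L →+* F) (h : MvPolynomial n L) :
    (awayMap τ h).comp (algebraMap L _) = (algebraMap F _).comp τ :=
  evalAway_comp_algebraMap _ _ _

theorem awayMap_X (τ : L →+* F) (h : MvPolynomial n L) (i : n) :
    awayMap τ h (algebraMap (MvPolynomial n L) _ (MvPolynomial.X i)) =
      algebraMap (MvPolynomial n F) _ (MvPolynomial.X i) := by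
  rw [awayMap, evalAway_algebraMap, eval₂_X]

/-- The base change `Spec F[t]_h ⟶ X_F` of a parametrization `Spec L[t]_h ⟶ X_L`. -/
def paramBaseChange {h : MvPolynomial n L} (y : Spec (.of (Localization.Away h)) ⟶ X)
    (hy : y ≫ f = specHom (algebraMap L (Localization.Away h)) ≫ specHom (algebraMap k L))
    (τ : L →+* F) (κ : k →+* F) (hκ : τ.comp (algebraMap k L) = κ) :
    Spec (.of (Localization.Away (MvPolynomial.map τ h))) ⟶ pullback f (specHom κ) :=
  pullback.lift (specHom (awayMap τ h) ≫ y) (specHom (algebraMap F _)) (by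
    rw [Category.assoc, hy, ← Category.assoc, ← specHom_comp, awayMap_comp, ← hκ,
      specHom_comp (algebraMap k L), ← Category.assoc, specHom_comp τ])

/-- If `y` is a dominant parametrization of `X_L`, then its base change to an extension of `L` is
dominant. -/
theorem exists_paramBaseChange_mem {h : MvPolynomial n L}
    (y : Spec (.of (Localization.Away h)) ⟶ X)
    (hy : y ≫ f = specHom (algebraMap L (Localization.Away h)) ≫ specHom (algebraMap k L))
    (hdom : DenseRange (pullback.lift y (specHom (algebraMap L (Localization.Away h))) hy))
    (τ : L →+* F) (κ : k →+* F) (hκ : τ.comp (algebraMap k L) = κ)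
    (O : (pullback f (specHom κ)).Opens)
    (hO : (O : Set (pullback f (specHom κ) : Scheme)).Nonempty) :
    ∃ (K : Type u) (_ : Field K) (γ : Localization.Away (MvPolynomial.map τ h) →+* K),
      (specHom γ) (specPt K) ∈ paramBaseChange f y hy τ κ hκ ⁻¹ᵁ O := by
  -- The image of `O` in X_L is open, so it meets the image of the parametrization; the two points
  -- with the same image are then realized over a common field `K`.
  obtain ⟨p, ⟨z, hzO, hz⟩⟩ :=
    hdom.exists_mem_open (isOpenMap_baseChangeMap f τ κ hκ _ O.2) (hO.image _)
  obtain ⟨K, hK, T, U, hTU, hU⟩ := exists_common_field_point _ _ p z hz.symm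
  obtain ⟨α, rfl⟩ := specHom_surjective T
  obtain ⟨β, hβ⟩ := specHom_surjective (U ≫ pullback.snd _ _)
  have hfst := hTU =≫ pullback.fst _ _
  have hsnd := hTU =≫ pullback.snd _ _
  rw [Category.assoc, Category.assoc, pullback.lift_fst, baseChangeMap_fst] at hfst
  rw [Category.assoc, Category.assoc, pullback.lift_snd, baseChangeMap_snd, ← Category.assoc U, hβ,
    ← specHom_comp, ← specHom_comp] at hsnd
  have hαβ (a : L) : α (algebraMap L _ a) = β (τ a) :=
    DFunLike.congr_fun (specHom_injective hsnd) a
  -- `α` on L[t]_h and `β` on F agree on L, so they glue to `γ` on F[t] localized at the conjugate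
  -- of `h`: this ring is the base change of L[t]_h to F.
  let ξ : n → K := fun i => α (algebraMap (MvPolynomial n L) _ (MvPolynomial.X i))
  have hξ : (eval₂Hom β ξ).comp (MvPolynomial.map τ) = α.comp (algebraMap (MvPolynomial n L) _) := by
    refine MvPolynomial.ringHom_ext (fun a => ?_) (fun i => ?_)
    · simp [← hαβ, IsScalarTower.algebraMap_apply L (MvPolynomial n L) (Localization.Away h)]
    · simp [ξ]
  let γ : Localization.Away (MvPolynomial.map τ h) →+* K := evalAway β ξ (by
    rw [← RingHom.comp_apply, hξ]
    exact (IsLocalization.Away.algebraMap_isUnit h).map α)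
  have hγ : γ.comp (awayMap τ h) = α := by
    refine ringHom_away_ext (fun a => ?_) (fun i => ?_)
    · rw [RingHom.comp_apply, awayMap_coeff, evalAway_algebraMap_coeff, hαβ]
    · rw [RingHom.comp_apply, awayMap_X, evalAway_algebraMap, eval₂_X]
  have hγm : specHom γ ≫ paramBaseChange f y hy τ κ hκ = U := by
    apply pullback.hom_ext
    · rw [Category.assoc, paramBaseChange, pullback.lift_fst, ← Category.assoc, ← specHom_comp, hγ,
        hfst]
    · rw [Category.assoc, paramBaseChange, pullback.lift_snd, hβ, ← specHom_comp,
        evalAway_comp_algebraMap]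
  refine ⟨K, hK, γ, ?_⟩
  change paramBaseChange f y hy τ κ hκ _ ∈ O
  rw [← Scheme.Hom.comp_apply, hγm, hU]
  exact hzO

/-- If `y` is a dominant parametrization of `X_L`, then the parametrized points with values in an
infinite extension `F` of `L` are dense in `X_F`, even off the zeros of a polynomial. -/
theorem exists_param_point_mem [Infinite F] {h : MvPolynomial n L} (hh : h ≠ 0)
    (y : Spec (.of (Localization.Away h)) ⟶ X)
    (hy : y ≫ f = specHom (algebraMap L (Localization.Away h)) ≫ specHom (algebraMap k L))
    (hdom : DenseRange (pullback.lift y (specHom (algebraMap L (Localization.Away h))) hy))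
    (τ : L →+* F) (κ : k →+* F) (hκ : τ.comp (algebraMap k L) = κ)
    (O : (pullback f (specHom κ)).Opens)
    (hO : (O : Set (pullback f (specHom κ) : Scheme)).Nonempty)
    (q : MvPolynomial n F) (hq : q ≠ 0) :
    ∃ (c : n → F) (hc : IsUnit (eval₂Hom τ c h)) (g : Spec (.of F) ⟶ pullback f (specHom κ)),
      eval c q ≠ 0 ∧ g ≫ pullback.fst _ _ = specHom (evalAway τ c hc) ≫ y ∧
      g ≫ pullback.snd _ _ = 𝟙 _ ∧ g (specPt F) ∈ O := by
  obtain ⟨K, hK, γ, hγ⟩ := exists_paramBaseChange_mem f y hy hdom τ κ hκ O hO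
  -- The preimage of `O` contains a nonempty basic open set of affine space, which has F-points
  -- because F is infinite.
  obtain ⟨s, hs, hsO⟩ := exists_basicOpen_of_isOpen γ _ hγ
  have hs0 : s ≠ 0 := by
    rintro rfl
    exact hs (map_zero _)
  have hh' : MvPolynomial.map τ h ≠ 0 :=
    fun h0 => hh (MvPolynomial.map_injective τ τ.injective (h0.trans (map_zero _).symm))
  obtain ⟨c, hc, hcs, hcq⟩ := exists_evalAway_ne_zero hh' s hs0 q hq
  have hc' : IsUnit (eval₂Hom τ c h) := by
    simpa [MvPolynomial.eval₂_map] using hc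
  refine ⟨c, hc', specHom (evalAway (RingHom.id F) c hc) ≫ paramBaseChange f y hy τ κ hκ, hcq,
    ?_, ?_, ?_⟩
  · rw [Category.assoc, paramBaseChange, pullback.lift_fst, ← Category.assoc, ← specHom_comp]
    congr 2
    refine evalAway_unique _ _ _ _ (fun a => ?_) (fun i => ?_)
    · rw [RingHom.comp_apply, awayMap_coeff, evalAway_algebraMap_coeff, RingHom.id_apply]
    · rw [RingHom.comp_apply, awayMap_X, evalAway_algebraMap, eval₂_X]
  · rw [Category.assoc, paramBaseChange, pullback.lift_snd, ← specHom_comp,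
      evalAway_comp_algebraMap, specHom_id]
  · rw [Scheme.Hom.comp_apply]
    exact hsO ((specHom_specPt_mem_basicOpen _ s).mpr hcs)

end Coordinate

/-! ### Surjectivity of the quotient morphism, representatives of rational maps -/

/-- The projection to a coequalizer of locally ringed spaces is surjective. -/
theorem coequalizer_π_surjective {A B : LocallyRingedSpace.{u}} (f g : A ⟶ B) :
    Function.Surjective (coequalizer.π f g).base := by
  let G := LocallyRingedSpace.forgetToSheafedSpace.{u} ⋙ SheafedSpace.forget _
  -- The forgetful functor to topological spaces preserves this coequalizer, so up to isomorphism
  -- the underlying map is a topological coequalizer projection.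
  have : Epi (G.map (coequalizer.π f g)) := by
    rw [← ι_comp_coequalizerComparison f g G, ← PreservesCoequalizer.iso_hom]
    apply epi_comp
  exact (TopCat.epi_iff_surjective _).mp this

/-- The quotient morphism `Xᵈ ⟶ Symᵈ X` is surjective. -/
theorem toSym_surjective {k : Type u} [Field k] {X : Scheme.{u}} (f : X ⟶ Spec (.of k)) (d : ℕ) :
    Function.Surjective (toSym f d).base :=
  coequalizer_π_surjective _ _

/-- A dominant rational map over `S` is represented by a dominant morphism over `S` on an open
subscheme. -/
theorem exists_representative_over {A Y S : Scheme.{u}} (s : A ⟶ S) (g : Y ⟶ S) (φ : A ⤏ Y)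
    (hφ : φ.IsDominant) (hover : φ.compHom g = Scheme.Hom.toRationalMap s) :
    ∃ (U : A.Opens) (v : U.toScheme ⟶ Y), v ≫ g = U.ι ≫ s ∧ DenseRange v := by
  obtain ⟨φ, rfl⟩ := φ.exists_rep
  have hφ' : IsDominant φ.hom := φ.isDominant_toRationalMap_iff.mp hφ
  obtain ⟨U, hU, hUl, hUr, e⟩ := Scheme.PartialMap.toRationalMap_eq_iff.mp hover
  have hUl' : U ≤ φ.domain := hUl
  -- Compatibility with the structure morphisms is known only on the dense open `U`; restricting to
  -- it keeps dominance.
  have hUr' : U ≤ (⊤ : A.Opens) := hUr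
  refine ⟨U, A.homOfLE hUl' ≫ φ.hom, ?_, ?_⟩
  · change A.homOfLE hUl' ≫ φ.hom ≫ g = A.homOfLE hUr' ≫ (⊤ : A.Opens).ι ≫ s at e
    rw [← Category.assoc (A.homOfLE hUr'), Scheme.homOfLE_ι] at e
    rw [Category.assoc, e]
  · have hdom : IsDominant (A.homOfLE hUl') := Opens.isDominant_homOfLE hU hUl'
    have : IsDominant (A.homOfLE hUl' ≫ φ.hom) := inferInstance
    exact this.denseRange

/-! ### Parametrizations from unirationality -/

section Parametrization

variable {k L : Type u} [Field k] [Field L]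

/-- A dominant rational map from affine space is represented on a basic open set whose image lies in
a given nonempty open set. -/
theorem exists_dominant_morphism_of_isUnirational {Y : Scheme.{u}} (g : Y ⟶ Spec (.of L))
    (hg : IsUnirational g) (O : Y.Opens) (hO : (O : Set Y).Nonempty) :
    ∃ (n : Type u) (h : MvPolynomial n L) (z : Spec (.of (Localization.Away h)) ⟶ Y), h ≠ 0 ∧
      z ≫ g = specHom (algebraMap L (Localization.Away h)) ∧ DenseRange z ∧ Set.range z ⊆ O := by
  obtain ⟨N, φ, hφ, hover⟩ := hg
  obtain ⟨U, v, hvg, hv⟩ := exists_representative_over _ g φ hφ hover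
  let n := ULift.{u} (Fin N)
  let A := 𝔸(n; Spec (.of L))
  have hAirr : IrreducibleSpace A := inferInstance
  have hopen (O₂ : Y.Opens) (hO₂ : (O₂ : Set Y).Nonempty) :
      ((U.ι ''ᵁ (v ⁻¹ᵁ O₂) : A.Opens) : Set A).Nonempty := by
    obtain ⟨w, hw⟩ := hv.exists_mem_open O₂.2 hO₂
    exact ⟨U.ι w, w, hw, rfl⟩
  let ε := AffineSpace.SpecIso n (.of L)
  let j : Spec (.of (MvPolynomial n L)) ⟶ A := ε.inv
  obtain ⟨t, ht⟩ := hopen O hO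
  obtain ⟨t, rfl⟩ := ε.inv.surjective t
  obtain ⟨_, ⟨h, rfl⟩, hth, hsub⟩ :=
    PrimeSpectrum.isTopologicalBasis_basic_opens.exists_subset_of_mem_open ht
      (j ⁻¹ᵁ (U.ι ''ᵁ (v ⁻¹ᵁ O))).2
  have hh : h ≠ 0 := by
    rintro rfl
    exact hth (Ideal.zero_mem _)
  let b : Spec (.of (Localization.Away h)) ⟶ Spec (.of (MvPolynomial n L)) :=
    specHom (algebraMap _ _)
  have hb : IsOpenImmersion b := inferInstanceAs (IsOpenImmersion (Spec.map _))
  have hbr : Set.range b = {s | s ∈ PrimeSpectrum.basicOpen h} :=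
    PrimeSpectrum.localization_away_comap_range (Localization.Away h) h
  have hbU (s) : (b ≫ j) s ∈ U.ι ''ᵁ (v ⁻¹ᵁ O) := by
    have : b s ∈ Set.range b := ⟨s, rfl⟩
    rw [hbr] at this
    exact hsub this
  let ℓ : Spec (.of (Localization.Away h)) ⟶ U.toScheme := IsOpenImmersion.lift U.ι (b ≫ j) (by
    rintro _ ⟨s, rfl⟩
    obtain ⟨w, -, hw⟩ := hbU s
    exact ⟨w, hw⟩)
  have hℓ : ℓ ≫ U.ι = b ≫ j := IsOpenImmersion.lift_fac _ _ _
  have hℓs (s) : U.ι (ℓ s) = (b ≫ j) s := by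
    rw [← hℓ, Scheme.Hom.comp_apply]
  refine ⟨n, h, ℓ ≫ v, hh, ?_, ?_, ?_⟩
  · rw [Category.assoc, hvg, ← Category.assoc, hℓ, Category.assoc]
    have h1 : j ≫ A ↘ Spec (.of L) = specHom C := AffineSpace.SpecIso_inv_over (.of L)
    rw [h1, ← specHom_comp]
    rfl
  · rw [DenseRange, dense_iff_inter_open]
    intro O₂ hO₂ hne
    have hr : (Set.range (b ≫ j)).Nonempty := ⟨ε.inv t, by
      have : t ∈ Set.range b := by rw [hbr]; exact hth
      obtain ⟨s, rfl⟩ := this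
      exact ⟨s, Scheme.Hom.comp_apply _ _ _⟩⟩
    -- Affine space is irreducible, so shrinking to the basic open set of `h` does not destroy
    -- dominance.
    obtain ⟨_, ⟨w, hw, rfl⟩, s, hs⟩ := nonempty_preirreducible_inter
      (U.ι ''ᵁ (v ⁻¹ᵁ ⟨O₂, hO₂⟩)).2 (b ≫ j).isOpenEmbedding.isOpen_range (hopen ⟨O₂, hO₂⟩ hne) hr
    rw [← hℓs] at hs
    refine ⟨v w, hw, s, ?_⟩
    rw [Scheme.Hom.comp_apply, U.ι.isOpenEmbedding.injective hs]
  · rintro _ ⟨s, rfl⟩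
    obtain ⟨w, hw, hws⟩ := hbU s
    rw [← hℓs] at hws
    rw [Scheme.Hom.comp_apply, ← U.ι.isOpenEmbedding.injective hws]
    exact hw

variable [Algebra k L] {X : Scheme.{u}} (f : X ⟶ Spec (.of k))

/-- If `X_L` is unirational over `L`, then there is a parametrization `Spec L[t]_h ⟶ X` that lands
in a given nonempty open set and induces a dominant morphism to `X_L`. -/
theorem exists_parametrization (hL : IsUnirational (pullback.snd f (specHom (algebraMap k L))))
    (V : X.Opens) (hV : (V : Set X).Nonempty) :
    ∃ (n : Type u) (h : MvPolynomial n L) (y : Spec (.of (Localization.Away h)) ⟶ X)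
      (hy : y ≫ f = specHom (algebraMap L (Localization.Away h)) ≫ specHom (algebraMap k L)),
      h ≠ 0 ∧ DenseRange (pullback.lift y (specHom (algebraMap L (Localization.Away h))) hy) ∧
      Set.range y ⊆ V := by
  have hsurj : Surjective (specHom (algebraMap k L)) :=
    ⟨fun x => ⟨specPt L, Subsingleton.elim _ _⟩⟩
  obtain ⟨x, hx⟩ := hV
  obtain ⟨x', rfl⟩ := (pullback.fst f (specHom (algebraMap k L))).surjective x
  obtain ⟨n, h, z, hh, hzg, hz, hzV⟩ := exists_dominant_morphism_of_isUnirational _ hL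
    (pullback.fst f (specHom (algebraMap k L)) ⁻¹ᵁ V) ⟨x', hx⟩
  have hy : (z ≫ pullback.fst _ _) ≫ f =
      specHom (algebraMap L (Localization.Away h)) ≫ specHom (algebraMap k L) := by
    rw [Category.assoc, pullback.condition, ← Category.assoc, hzg]
  have hlift : pullback.lift (z ≫ pullback.fst _ _) _ hy = z := by
    apply pullback.hom_ext
    · rw [pullback.lift_fst]
    · rw [pullback.lift_snd, hzg]
  refine ⟨n, h, z ≫ pullback.fst _ _, hy, hh, by rwa [hlift], ?_⟩
  rintro _ ⟨s, rfl⟩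
  rw [Scheme.Hom.comp_apply]
  exact hzV ⟨s, rfl⟩

end Parametrization

/-! ### Closedness and residue fields of L-valued points -/

section ResidueField

variable {k L : Type u} [Field k] [Field L] [Algebra k L] {X : Scheme.{u}} (f : X ⟶ Spec (.of k))

/-- A point of a scheme locally of finite type over `k` with values in a finite extension of `k` is
closed. -/
theorem isClosed_singleton_of_finite [LocallyOfFiniteType f] [FiniteDimensional k L]
    (p : Spec (.of L) ⟶ X) (hp : p ≫ f = specHom (algebraMap k L)) :
    IsClosed {p (specPt L)} := by
  have : LocallyOfFiniteType (p ≫ f) := by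
    rw [hp]
    refine (HasRingHomProperty.Spec_iff (P := @LocallyOfFiniteType)).mpr ?_
    exact RingHom.finiteType_algebraMap.mpr inferInstance
  have : LocallyOfFiniteType p := locallyOfFiniteType_of_comp p f
  have : JacobsonSpace X := LocallyOfFiniteType.jacobsonSpace f
  -- A morphism locally of finite type to a Jacobson scheme sends closed points to closed points.
  exact p.closePoints_subset_preimage_closedPoints
    (IsLocalRing.isClosed_singleton_closedPoint L)

/-- If the values of functions at an `L`-valued point generate `L` over `k`, then the residue field
of the underlying point is `L`. -/
theorem exists_residueIso {V : X.Opens} (hV : IsAffineOpen V) (χ : Γ(X, V) →+* L)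
    (hp : (specHom χ ≫ hV.fromSpec) ≫ f = specHom (algebraMap k L)) (b : Γ(X, V))
    (hb : IntermediateField.adjoin k {χ b} = ⊤) :
    ∃ (x : X) (iso : ResidueIso f L x), x = (specHom χ ≫ hV.fromSpec) (specPt L) ∧
      Spec.map (CommRingCat.ofHom (letI := residueAlgebra f x; iso.toRingEquiv.toRingHom)) ≫
        X.fromSpecResidueField x = specHom χ ≫ hV.fromSpec := by
  set p : Spec (.of L) ⟶ X := specHom χ ≫ hV.fromSpec with hpdef
  let x : X := p (specPt L)
  let δ : X.residueField x →+* L := (X.descResidueField (Scheme.stalkClosedPointTo p)).hom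
  have hδ : specHom δ ≫ X.fromSpecResidueField x = p :=
    Scheme.descResidueField_stalkClosedPointTo_fromSpecResidueField L X p
  let := residueAlgebra f x
  have hk : X.fromSpecResidueField x ≫ f = specHom (algebraMap k (X.residueField x)) :=
    (Spec.map_preimage _).symm
  have hδk : δ.comp (algebraMap k (X.residueField x)) = algebraMap k L := by
    apply specHom_injective
    rw [specHom_comp, ← hk, ← Category.assoc, hδ, hp]
  let δ' : X.residueField x →ₐ[k] L := { δ with commutes' := DFunLike.congr_fun hδk }
  -- Evaluation of functions on `V` at the point factors through the residue field, since the point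
  -- lies in `V`.
  have hχ : ∃ θ : Γ(X, V) →+* X.residueField x, δ.comp θ = χ := by
    have hxV : x ∈ V := by
      have h1 : hV.fromSpec (specHom χ (specPt L)) ∈ Set.range hV.fromSpec := ⟨_, rfl⟩
      rw [hV.range_fromSpec, ← Scheme.Hom.comp_apply] at h1
      exact h1
    let q : Spec (.of (X.residueField x)) ⟶ Spec Γ(X, V) :=
      IsOpenImmersion.lift hV.fromSpec (X.fromSpecResidueField x) (by
        rw [hV.range_fromSpec]
        rintro _ ⟨s, rfl⟩
        rw [Scheme.fromSpecResidueField_apply]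
        exact hxV)
    obtain ⟨θ, hθ⟩ := specHom_surjective (R := Γ(X, V)) q
    refine ⟨θ, ?_⟩
    apply specHom_injective
    rw [← cancel_mono hV.fromSpec, specHom_comp, ← hθ, Category.assoc]
    refine Eq.trans ?_ hδ
    congr 1
    exact IsOpenImmersion.lift_fac _ _ _
  obtain ⟨θ, hθ⟩ := hχ
  -- The image of the residue field is an intermediate field containing the generator `χ b`.
  have hsurj : Function.Surjective δ' := by
    have h1 : IntermediateField.adjoin k {χ b} ≤ δ'.fieldRange := by
      rw [IntermediateField.adjoin_simple_le_iff]
      exact ⟨θ b, DFunLike.congr_fun hθ b⟩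
    rw [hb] at h1
    intro l
    exact h1 (IntermediateField.mem_top)
  exact ⟨x, AlgEquiv.ofBijective δ' ⟨δ.injective, hsurj⟩, rfl, hδ⟩

end ResidueField

/-! ### Moving the coordinates of a tuple one at a time -/

section Tuples

variable {k L F : Type u} [Field k] [Field L] [Field F] [Algebra k L] [Algebra k F]
  {X : Scheme.{u}} (f : X ⟶ Spec (.of k)) {n : Type u} {d : ℕ}

/-- The point of `Xᵈ` given by a tuple of points of `X` with values in `F`. -/
def tuplePoint (z : Fin d → (Spec (.of F) ⟶ X)) (hz : ∀ i, z i ≫ f = specHom (algebraMap k F)) :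
    power f d :=
  (WidePullback.lift (specHom (algebraMap k F)) z hz : Spec (.of F) ⟶ power f d) (specPt F)

/-- The morphism `X_F ⟶ Xᵈ` that fixes all coordinates but the one with index `i`. -/
def replaceCoord (z : Fin d → (Spec (.of F) ⟶ X))
    (hz : ∀ i, z i ≫ f = specHom (algebraMap k F)) (i : Fin d) :
    pullback f (specHom (algebraMap k F)) ⟶ power f d :=
  WidePullback.lift (pullback.snd _ _ ≫ specHom (algebraMap k F))
    (fun j => if j = i then pullback.fst _ _ else pullback.snd _ _ ≫ z j) (fun j => by
      split_ifs
      · exact pullback.condition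
      · rw [Category.assoc, hz])

theorem update_comp {z : Fin d → (Spec (.of F) ⟶ X)}
    (hz : ∀ i, z i ≫ f = specHom (algebraMap k F)) (i : Fin d) {g : Spec (.of F) ⟶ X}
    (hg : g ≫ f = specHom (algebraMap k F)) (j : Fin d) :
    Function.update z i g j ≫ f = specHom (algebraMap k F) := by
  by_cases hj : j = i
  · subst hj
    rwa [Function.update_self]
  · rw [Function.update_of_ne hj, hz]

/-- Thus the preimage of an open set under `replaceCoord` describes the admissible new values of one
coordinate. -/
theorem replaceCoord_apply (z : Fin d → (Spec (.of F) ⟶ X))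
    (hz : ∀ i, z i ≫ f = specHom (algebraMap k F)) (i : Fin d)
    (g : Spec (.of F) ⟶ pullback f (specHom (algebraMap k F))) (hg : g ≫ pullback.snd _ _ = 𝟙 _)
    (x : Spec (.of F) ⟶ X) (hx : g ≫ pullback.fst _ _ = x)
    (hxf : x ≫ f = specHom (algebraMap k F)) :
    replaceCoord f z hz i (g (specPt F)) =
      tuplePoint f (Function.update z i x) (update_comp f hz i hxf) := by
  rw [← Scheme.Hom.comp_apply, tuplePoint]
  refine congrArg (fun m : Spec (.of F) ⟶ power f d => m (specPt F)) ?_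
  apply WidePullback.hom_ext
  · intro j
    rw [Category.assoc, replaceCoord, WidePullback.lift_π, WidePullback.lift_π]
    by_cases hj : j = i
    · subst hj
      rw [if_pos rfl, Function.update_self, hx]
    · rw [if_neg hj, Function.update_of_ne hj, ← Category.assoc, hg, Category.id_comp]
  · rw [Category.assoc, replaceCoord, WidePullback.lift_base, WidePullback.lift_base,
      ← Category.assoc, hg, Category.id_comp]

theorem evalAway_comp {h : MvPolynomial n L}
    {y : Spec (.of (Localization.Away h)) ⟶ X}
    (hy : y ≫ f = specHom (algebraMap L (Localization.Away h)) ≫ specHom (algebraMap k L))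
    (τ : L →ₐ[k] F) (c : n → F) (hc : IsUnit (eval₂Hom (τ : L →+* F) c h)) :
    (specHom (evalAway (τ : L →+* F) c hc) ≫ y) ≫ f = specHom (algebraMap k F) := by
  rw [Category.assoc, hy, ← Category.assoc, ← specHom_comp, evalAway_comp_algebraMap,
    ← specHom_comp, τ.comp_algebraMap]

/-- Every nonempty open subset of `Xᵈ` with a point over `F` contains a tuple of parametrized points
at which a given nonconstant function takes pairwise different values. -/
theorem exists_param_tuple_mem [Infinite F] {h : MvPolynomial n L} (hh : h ≠ 0)
    (y : Spec (.of (Localization.Away h)) ⟶ X)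
    (hy : y ≫ f = specHom (algebraMap L (Localization.Away h)) ≫ specHom (algebraMap k L))
    (hdom : DenseRange (pullback.lift y (specHom (algebraMap L (Localization.Away h))) hy))
    (τ : Fin d → L →ₐ[k] F) (W : (power f d).Opens) (z : Fin d → (Spec (.of F) ⟶ X))
    (hz : ∀ i, z i ≫ f = specHom (algebraMap k F)) (hzW : tuplePoint f z hz ∈ W)
    (r : Localization.Away h) (hr : d = 1 ∨ r ∉ Set.range (algebraMap L (Localization.Away h))) :
    ∃ (c : Fin d → n → F) (hc : ∀ i, IsUnit (eval₂Hom (τ i : L →+* F) (c i) h)),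
      tuplePoint f (fun i => specHom (evalAway (τ i : L →+* F) (c i) (hc i)) ≫ y)
        (fun i => evalAway_comp f hy (τ i) (c i) (hc i)) ∈ W ∧
      Function.Injective fun i => evalAway (τ i : L →+* F) (c i) (hc i) r := by
  -- Induction on the set `s` of coordinates already moved; `v` records the values of `r` there,
  -- which later choices must avoid.
  suffices key : ∀ s : Finset (Fin d), ∃ (w : Fin d → (Spec (.of F) ⟶ X))
      (hw : ∀ i, w i ≫ f = specHom (algebraMap k F)) (v : Fin d → F), tuplePoint f w hw ∈ W ∧
      Set.InjOn v s ∧ ∀ i ∈ s, ∃ (c : n → F) (hc : IsUnit (eval₂Hom (τ i : L →+* F) c h)),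
        w i = specHom (evalAway (τ i : L →+* F) c hc) ≫ y ∧
        v i = evalAway (τ i : L →+* F) c hc r by
    obtain ⟨w, hw, v, hW, hv, hs⟩ := key Finset.univ
    choose c hc hwc hvc using fun i => hs i (Finset.mem_univ i)
    obtain rfl := funext hwc
    obtain rfl := funext hvc
    exact ⟨c, hc, hW, fun i j hij => hv (by simp) (by simp) hij⟩
  intro s
  classical
  induction s using Finset.induction_on with
  | empty => exact ⟨z, hz, fun _ => 0, hzW, by simp, by simp⟩
  | insert i s his ih =>
    obtain ⟨w, hw, v, hW, hv, hs⟩ := ih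
    obtain ⟨q, hq0, hq⟩ : ∃ q : MvPolynomial n F, q ≠ 0 ∧ ∀ (c : n → F)
        (hc : IsUnit (eval₂Hom (τ i : L →+* F) c h)), eval c q ≠ 0 →
          ∀ j ∈ s, evalAway (τ i : L →+* F) c hc r ≠ v j := by
      rcases hr with rfl | hr
      · refine ⟨1, one_ne_zero, fun c hc _ j hj => absurd hj ?_⟩
        rwa [Subsingleton.elim j i]
      · choose q hq0 hq using fun j =>
          exists_polynomial_avoiding hh (τ i : L →+* F) r hr (v j)
        refine ⟨∏ j ∈ s, q j, Finset.prod_ne_zero_iff.mpr fun j _ => hq0 j, ?_⟩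
        intro c hc hne j hj
        rw [map_prod] at hne
        exact hq j c hc (Finset.prod_ne_zero_iff.mp hne j hj)
    -- The current i-th coordinate is itself an admissible value.
    have hne : ((replaceCoord f w hw i ⁻¹ᵁ W : (pullback f (specHom (algebraMap k F))).Opens) :
        Set (pullback f (specHom (algebraMap k F)) : Scheme)).Nonempty := by
      refine ⟨pullback.lift (w i) (𝟙 _) (by rw [hw, Category.id_comp]) (specPt F), ?_⟩
      change replaceCoord f w hw i _ ∈ W
      rw [replaceCoord_apply f w hw i _ (pullback.lift_snd _ _ _) (w i) (pullback.lift_fst _ _ _)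
        (hw i)]
      simpa only [Function.update_eq_self] using hW
    obtain ⟨c, hc, g, hcq, hg1, hg2, hgO⟩ := exists_param_point_mem f hh y hy hdom
      (τ i : L →+* F) (algebraMap k F) (τ i).comp_algebraMap _ hne q hq0
    refine ⟨Function.update w i (specHom (evalAway (τ i : L →+* F) c hc) ≫ y),
      update_comp f hw i (evalAway_comp f hy (τ i) c hc),
      Function.update v i (evalAway (τ i : L →+* F) c hc r), ?_, ?_, ?_⟩
    · rw [← replaceCoord_apply f w hw i g hg2 _ hg1 (evalAway_comp f hy (τ i) c hc)]
      exact hgO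
    · have hvs : ∀ j ∈ s, Function.update v i (evalAway (τ i : L →+* F) c hc r) j = v j :=
        fun j hj => Function.update_of_ne (by rintro rfl; exact his hj) _ _
      rw [Finset.coe_insert, Set.injOn_insert (by simpa using his)]
      refine ⟨fun j hj l hl hjl => ?_, ?_⟩
      · rw [hvs j hj, hvs l hl] at hjl
        exact hv hj hl hjl
      · rw [Function.update_self]
        rintro ⟨j, hj, hjv⟩
        rw [hvs j hj] at hjv
        exact hq c hc hcq j hj hjv.symm
    · intro j hj
      by_cases hji : j = i
      · subst hji
        exact ⟨c, hc, Function.update_self _ _ _, Function.update_self _ _ _⟩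
      · rw [Function.update_of_ne hji, Function.update_of_ne hji]
        exact hs j (Finset.mem_of_mem_insert_of_ne hj hji)

end Tuples

/-! ### From independent parameters to conjugate parameters -/

section Conjugates

variable {k L F : Type u} [Field k] [Field L] [Field F] [Algebra k L] [Algebra k F] {n : Type u}
  {d : ℕ}

/-- A function on a basic open set of affine space over `F` that does not vanish at some point does
not vanish at some tuple of conjugates. -/
theorem exists_evalAway_conjugates_ne_zero [Infinite k] (e : Module.Basis (Fin d) k L)
    (τ : Fin d → L →ₐ[k] F) (hτ : Function.Injective τ) {H : MvPolynomial (Fin d × n) F}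
    (s : Localization.Away H) (c : Fin d × n → F) (hc : IsUnit (eval₂Hom (RingHom.id F) c H))
    (hs : evalAway (RingHom.id F) c hc s ≠ 0) :
    ∃ (a : n → L) (ha : IsUnit (eval₂Hom (RingHom.id F) (fun ij => τ ij.1 (a ij.2)) H)),
      evalAway (RingHom.id F) _ ha s ≠ 0 := by
  obtain ⟨p, m, hp⟩ := exists_numerator s
  have hval (c : Fin d × n → F) (hc : IsUnit (eval₂Hom (RingHom.id F) c H)) :
      evalAway (RingHom.id F) c hc s * eval c H ^ m = eval c p := by
    have := congrArg (evalAway (RingHom.id F) c hc) hp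
    rw [map_mul, evalAway_algebraMap, evalAway_algebraMap] at this
    rw [← map_pow]
    exact this
  have hcH : eval c H ≠ 0 := hc.ne_zero
  have hcp : eval c (p * H) ≠ 0 := by
    rw [map_mul, ← hval c hc]
    exact mul_ne_zero (mul_ne_zero hs (pow_ne_zero _ hcH)) hcH
  obtain ⟨a, ha⟩ := exists_eval_conjugates_ne_zero e τ hτ (p * H) c hcp
  rw [map_mul] at ha
  have ha' : IsUnit (eval₂Hom (RingHom.id F) (fun ij : Fin d × n => τ ij.1 (a ij.2)) H) :=
    (right_ne_zero_of_mul ha).isUnit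
  refine ⟨a, ha', fun h0 => left_ne_zero_of_mul ha ?_⟩
  rw [← hval _ ha', h0, zero_mul]

/-- The product of the conjugates of `h` in separate groups of variables. -/
def conjProd (τ : Fin d → L →ₐ[k] F) (h : MvPolynomial n L) : MvPolynomial (Fin d × n) F :=
  ∏ i, rename (Prod.mk i) (MvPolynomial.map (τ i : L →+* F) h)

/-- Inverting `conjProd` therefore means that the i-th group of variables avoids the zeros of the
i-th conjugate of `h`, for every i. -/
theorem eval₂Hom_conjProd (τ : Fin d → L →ₐ[k] F) (h : MvPolynomial n L) (c : Fin d × n → F) :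
    eval₂Hom (RingHom.id F) c (conjProd τ h) =
      ∏ i, eval₂Hom (τ i : L →+* F) (fun j => c (i, j)) h := by
  rw [conjProd, map_prod]
  refine Finset.prod_congr rfl fun i _ => ?_
  rw [coe_eval₂Hom, eval₂_rename, eval₂_map, RingHom.id_comp]
  rfl

/-- The homomorphism from `L[t]_h` that applies the `i`-th embedding to the coefficients and uses
the `i`-th group of variables. -/
def conjMap (τ : Fin d → L →ₐ[k] F) (h : MvPolynomial n L) (i : Fin d) :
    Localization.Away h →+* Localization.Away (conjProd τ h) :=
  evalAway ((algebraMap F _).comp (τ i : L →+* F))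
    (fun j => algebraMap (MvPolynomial (Fin d × n) F) _ (MvPolynomial.X (i, j))) (by
      have h1 : eval₂Hom ((algebraMap F (Localization.Away (conjProd τ h))).comp (τ i : L →+* F))
          (fun j => algebraMap (MvPolynomial (Fin d × n) F) _ (MvPolynomial.X (i, j))) =
          (algebraMap (MvPolynomial (Fin d × n) F) _).comp
            ((rename (Prod.mk i) : MvPolynomial n F →ₐ[F] _).toRingHom.comp
              (MvPolynomial.map (τ i : L →+* F))) := by
        refine MvPolynomial.ringHom_ext (fun a => ?_) (fun j => ?_)
        · simp [IsScalarTower.algebraMap_apply F (MvPolynomial (Fin d × n) F)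
            (Localization.Away (conjProd τ h))]
        · simp
      rw [h1, RingHom.comp_apply]
      exact isUnit_of_dvd_unit (map_dvd _ (Finset.dvd_prod_of_mem
        (fun i => rename (Prod.mk i) (MvPolynomial.map (τ i : L →+* F) h)) (Finset.mem_univ i)))
        (IsLocalization.Away.algebraMap_isUnit (S := Localization.Away (conjProd τ h))
          (conjProd τ h)))

theorem evalAway_comp_conjMap (τ : Fin d → L →ₐ[k] F) (h : MvPolynomial n L) (i : Fin d)
    (c : Fin d × n → F) (hc : IsUnit (eval₂Hom (RingHom.id F) c (conjProd τ h)))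
    (hci : IsUnit (eval₂Hom (τ i : L →+* F) (fun j => c (i, j)) h)) :
    (evalAway (RingHom.id F) c hc).comp (conjMap τ h i) =
      evalAway (τ i : L →+* F) (fun j => c (i, j)) hci := by
  refine evalAway_unique _ _ _ _ (fun a => ?_) (fun j => ?_)
  · rw [RingHom.comp_apply, conjMap, evalAway_algebraMap_coeff, RingHom.comp_apply,
      evalAway_algebraMap_coeff, RingHom.id_apply]
  · rw [RingHom.comp_apply, conjMap, evalAway_algebraMap, eval₂_X, evalAway_algebraMap, eval₂_X]

variable {X : Scheme.{u}} (f : X ⟶ Spec (.of k))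

/-- An open subset of `Xᵈ` that contains a tuple of parametrized points at which a function takes
pairwise different values contains such a tuple of conjugate points. -/
theorem exists_conjugate_tuple_mem [Infinite k] (hd : 0 < d) (e : Module.Basis (Fin d) k L)
    (τ : Fin d → L →ₐ[k] F) (hτ : Function.Injective τ) {h : MvPolynomial n L}
    (y : Spec (.of (Localization.Away h)) ⟶ X)
    (hy : y ≫ f = specHom (algebraMap L (Localization.Away h)) ≫ specHom (algebraMap k L))
    (W : (power f d).Opens) (r : Localization.Away h) (c : Fin d → n → F)
    (hc : ∀ i, IsUnit (eval₂Hom (τ i : L →+* F) (c i) h))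
    (hW : tuplePoint f (fun i => specHom (evalAway (τ i : L →+* F) (c i) (hc i)) ≫ y)
        (fun i => evalAway_comp f hy (τ i) (c i) (hc i)) ∈ W)
    (hinj : Function.Injective fun i => evalAway (τ i : L →+* F) (c i) (hc i) r) :
    ∃ (a : n → L) (ha : IsUnit (eval₂Hom (RingHom.id L) a h))
      (hz : ∀ i, (specHom ((τ i : L →+* F).comp (evalAway (RingHom.id L) a ha)) ≫ y) ≫ f =
        specHom (algebraMap k F)),
      tuplePoint f _ hz ∈ W ∧
      Function.Injective fun i => τ i (evalAway (RingHom.id L) a ha r) := by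
  classical
  let S := Localization.Away (conjProd τ h)
  -- The universal tuple of parametrized points; it turns `W` into an open condition on all `d`
  -- groups of parameters together.
  let T : Spec (.of S) ⟶ power f d :=
    WidePullback.lift (specHom ((algebraMap F S).comp (algebraMap k F)))
      (fun i => specHom (conjMap τ h i) ≫ y) (fun i => by
        rw [Category.assoc, hy, ← Category.assoc, ← specHom_comp, conjMap,
          evalAway_comp_algebraMap, ← specHom_comp, RingHom.comp_assoc, (τ i).comp_algebraMap])
  have hT (c : Fin d × n → F) (hc : IsUnit (eval₂Hom (RingHom.id F) c (conjProd τ h)))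
      (z : Fin d → (Spec (.of F) ⟶ X)) (hz : ∀ i, z i ≫ f = specHom (algebraMap k F))
      (hzc : ∀ i, specHom ((evalAway (RingHom.id F) c hc).comp (conjMap τ h i)) ≫ y = z i) :
      T (specHom (evalAway (RingHom.id F) c hc) (specPt F)) = tuplePoint f z hz := by
    rw [← Scheme.Hom.comp_apply, tuplePoint]
    refine congrArg (fun m : Spec (.of F) ⟶ power f d => m (specPt F)) ?_
    apply WidePullback.hom_ext
    · intro i
      rw [Category.assoc, WidePullback.lift_π, WidePullback.lift_π, ← Category.assoc,
        ← specHom_comp, hzc]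
    · rw [Category.assoc, WidePullback.lift_base, WidePullback.lift_base, ← specHom_comp,
        ← RingHom.comp_assoc, evalAway_comp_algebraMap, RingHom.id_comp]
  let c' : Fin d × n → F := fun ij => c ij.1 ij.2
  have hc' : IsUnit (eval₂Hom (RingHom.id F) c' (conjProd τ h)) := by
    rw [eval₂Hom_conjProd]
    exact IsUnit.prod_univ_iff.mpr hc
  have hcc (i) := evalAway_comp_conjMap τ h i c' hc' (hc i)
  obtain ⟨s, hs, hsW⟩ := exists_basicOpen_of_isOpen (evalAway (RingHom.id F) c' hc') (T ⁻¹ᵁ W) (by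
    change T _ ∈ W
    rw [hT c' hc' _ (fun i => evalAway_comp f hy (τ i) (c i) (hc i)) (fun i => by rw [hcc])]
    exact hW)
  -- Nonvanishing of this discriminant-like product says that the `d` values of `r` are pairwise
  -- different.
  let D : S := ∏ i, ∏ j ∈ Finset.univ.erase i, (conjMap τ h i r - conjMap τ h j r)
  have hD (φ : S →+* F) : φ D ≠ 0 ↔ Function.Injective fun i => φ (conjMap τ h i r) := by
    simp only [D, map_prod, map_sub, Finset.prod_ne_zero_iff, Finset.mem_univ, true_imp_iff,
      Finset.mem_erase, and_true, sub_ne_zero]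
    exact ⟨fun H i j hij => by_contra fun hne => H i j (Ne.symm hne) hij,
      fun H i j hne hij => hne (H hij).symm⟩
  have hDc : evalAway (RingHom.id F) c' hc' D ≠ 0 := by
    rw [hD]
    convert hinj using 2 with i
    exact DFunLike.congr_fun (hcc i) r
  obtain ⟨a, ha, has⟩ := exists_evalAway_conjugates_ne_zero e τ hτ (s * D) c' hc'
    (by rw [map_mul]; exact mul_ne_zero hs hDc)
  rw [map_mul] at has
  have hτa (i : Fin d) : eval₂Hom (τ i : L →+* F) (fun j => τ i (a j)) h =
      (τ i : L →+* F) (eval₂Hom (RingHom.id L) a h) := by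
    rw [map_eval₂Hom, RingHom.comp_id]
    rfl
  have hai (i : Fin d) : IsUnit (eval₂Hom (τ i : L →+* F) (fun j => τ i (a j)) h) := by
    rw [eval₂Hom_conjProd] at ha
    exact IsUnit.prod_univ_iff.mp ha i
  have ha' : IsUnit (eval₂Hom (RingHom.id L) a h) := by
    have := hai ⟨0, hd⟩
    rw [hτa] at this
    exact ((map_ne_zero _).mp this.ne_zero).isUnit
  -- At conjugate parameters, the i-th evaluation is `τ i` applied to one evaluation over L.
  have hcomp (i : Fin d) : (evalAway (RingHom.id F) _ ha).comp (conjMap τ h i) =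
      (τ i : L →+* F).comp (evalAway (RingHom.id L) a ha') := by
    rw [evalAway_comp_conjMap τ h i _ ha (hai i)]
    refine (evalAway_unique _ _ _ _ (fun l => ?_) (fun j => ?_)).symm
    · rw [RingHom.comp_apply, evalAway_algebraMap_coeff, RingHom.id_apply]
    · rw [RingHom.comp_apply, evalAway_algebraMap, eval₂_X]
      rfl
  have hz (i : Fin d) : (specHom ((τ i : L →+* F).comp (evalAway (RingHom.id L) a ha')) ≫ y) ≫ f =
      specHom (algebraMap k F) := by
    rw [← hcomp, evalAway_comp_conjMap τ h i _ ha (hai i)]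
    exact evalAway_comp f hy (τ i) _ (hai i)
  refine ⟨a, ha', hz, ?_, ?_⟩
  · rw [← hT _ ha _ hz (fun i => by rw [hcomp])]
    exact hsW ((specHom_specPt_mem_basicOpen _ s).mpr (left_ne_zero_of_mul has))
  · have := (hD _).mp (right_ne_zero_of_mul has)
    convert this using 2 with i
    exact (DFunLike.congr_fun (hcomp i) r).symm

end Conjugates

/-! ### Generic generation of L and density -/

section Density

variable {k L : Type u} [Field k] [Field L] [Algebra k L] {X : Scheme.{u}} (f : X ⟶ Spec (.of k))

/-- A dominant parametrization of a scheme of positive dimension does not make all functions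
constant. -/
theorem exists_nonconstant [Infinite k] [LocallyOfFiniteType f] [FiniteDimensional k L]
    (hX : 0 < topologicalKrullDim X) {n : Type u} {h : MvPolynomial n L} (hh : h ≠ 0)
    (y : Spec (.of (Localization.Away h)) ⟶ X)
    (hy : y ≫ f = specHom (algebraMap L (Localization.Away h)) ≫ specHom (algebraMap k L))
    (hdom : DenseRange (pullback.lift y (specHom (algebraMap L (Localization.Away h))) hy))
    {V : X.Opens} (hV : IsAffineOpen V) (ψ : Γ(X, V) →+* Localization.Away h)
    (hψ : specHom ψ ≫ hV.fromSpec = y) :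
    ∃ b : Γ(X, V), ψ b ∉ Set.range (algebraMap L (Localization.Away h)) := by
  -- If all functions pull back to constants, `y` factors through a single L-valued point. That
  -- point is closed and dense, so X has one point and dimension at most 0.
  by_contra! hcon
  have : Infinite L := Infinite.of_injective _ (algebraMap k L).injective
  obtain ⟨a, ha⟩ := exists_eval_ne_zero h hh
  let ε : Localization.Away h →+* L := evalAway (RingHom.id L) a (IsUnit.mk0 _ ha)
  have hε : ε.comp (algebraMap L _) = RingHom.id L := evalAway_comp_algebraMap _ _ _
  have hχ : (algebraMap L (Localization.Away h)).comp (ε.comp ψ) = ψ := by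
    ext b
    obtain ⟨l, hl⟩ := hcon b
    have := DFunLike.congr_fun hε l
    rw [RingHom.comp_apply, hl, RingHom.id_apply] at this
    rw [RingHom.comp_apply, RingHom.comp_apply, this, hl]
  let p : Spec (.of L) ⟶ X := specHom (ε.comp ψ) ≫ hV.fromSpec
  have hpy : specHom (algebraMap L (Localization.Away h)) ≫ p = y := by
    rw [← Category.assoc, ← specHom_comp, hχ, hψ]
  have hp : p ≫ f = specHom (algebraMap k L) := by
    have h1 : specHom ε ≫ y = p := by rw [← hψ, ← Category.assoc, ← specHom_comp]
    rw [← h1, Category.assoc, hy, ← Category.assoc, ← specHom_comp, hε, specHom_id,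
      Category.id_comp]
  have hsurj : Surjective (specHom (algebraMap k L)) :=
    ⟨fun x => ⟨specPt L, Subsingleton.elim _ _⟩⟩
  have hyd : DenseRange y := by
    have := (pullback.fst f (specHom (algebraMap k L))).surjective.denseRange.comp hdom
      (pullback.fst f (specHom (algebraMap k L))).continuous
    convert this using 1
    ext s
    rw [Function.comp_apply, ← Scheme.Hom.comp_apply, pullback.lift_fst]
  have hX1 (x : X) : x = p (specPt L) := by
    have h1 : Set.range y ⊆ {p (specPt L)} := by
      rintro _ ⟨s, rfl⟩
      rw [← hpy, Scheme.Hom.comp_apply, Set.mem_singleton_iff]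
      exact congrArg p (Subsingleton.elim _ _)
    exact closure_minimal h1 (isClosed_singleton_of_finite f p hp) (hyd x)
  have : Subsingleton X := ⟨fun x x' => (hX1 x).trans (hX1 x').symm⟩
  have : Subsingleton (TopologicalSpace.IrreducibleCloseds X) := by
    refine ⟨fun S T => TopologicalSpace.IrreducibleCloseds.ext ?_⟩
    rw [S.isIrreducible.nonempty.eq_univ, T.isIrreducible.nonempty.eq_univ]
  exact absurd hX (not_lt.mpr Order.krullDim_nonpos_of_subsingleton)

/-- A point over `L` whose residue field is `L` gives rise to a point of the symmetric power; it is
the image of the tuple of its conjugates. -/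
theorem mem_closedPointsWithResidueField_of_tuple {F : Type u} [Field F] [Algebra k F]
    [LocallyOfFiniteType f] [FiniteDimensional k L] {d : ℕ}
    (σ : Fin d ≃ (L →ₐ[k] AlgebraicClosure k)) (ι : AlgebraicClosure k →ₐ[k] F)
    (p : Spec (.of L) ⟶ X) (hp : p ≫ f = specHom (algebraMap k L)) (x : X)
    (iso : ResidueIso f L x) (hx : x = p (specPt L))
    (hiso : Spec.map (CommRingCat.ofHom
      (letI := residueAlgebra f x; iso.toRingEquiv.toRingHom)) ≫ X.fromSpecResidueField x = p)
    (hz : ∀ i, (specHom ((ι : AlgebraicClosure k →+* F).comp (σ i : L →+* AlgebraicClosure k)) ≫ p)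
      ≫ f = specHom (algebraMap k F)) :
    (toSym f d).base (tuplePoint f _ hz) ∈ closedPointsWithResidueField f L d := by
  let := residueAlgebra f x
  let e : Fin d ≃ Embeddings f x := σ.trans (AlgEquiv.arrowCongr iso.symm AlgEquiv.refl)
  have he (i) : geomPoint f x (e i) = specHom (σ i : L →+* AlgebraicClosure k) ≫ p := by
    rw [← hiso, ← Category.assoc]
    refine congrArg (· ≫ X.fromSpecResidueField x) ?_
    exact specHom_comp iso.toRingEquiv.toRingHom (σ i : L →+* AlgebraicClosure k)
  refine ⟨x, ?_, ⟨iso⟩, e, ?_⟩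
  · rw [hx]
    exact isClosed_singleton_of_finite f p hp
  -- The tuple over F is the geometric tuple over the algebraic closure of k composed with `ι`, so
  -- both have the same underlying point.
  · have h1 : (WidePullback.lift (specHom (algebraMap k F)) _ hz : Spec (.of F) ⟶ power f d) =
        specHom (ι : AlgebraicClosure k →+* F) ≫ conjugates f x e := by
      apply WidePullback.hom_ext
      · intro i
        rw [Category.assoc, conjugates, WidePullback.lift_π, WidePullback.lift_π, he,
          ← Category.assoc, specHom_comp]
      · rw [Category.assoc, conjugates, WidePullback.lift_base, WidePullback.lift_base]
        exact ((specHom_comp _ _).symm.trans (congrArg specHom ι.comp_algebraMap)).symm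
    have h2 : tuplePoint f _ hz = conjugates f x e (specPt (AlgebraicClosure k)) := by
      rw [tuplePoint, h1, Scheme.Hom.comp_apply]
      exact congrArg (conjugates f x e) (Subsingleton.elim _ _)
    rw [h2]
    rfl

/-- A nonempty open subset of `Xᵈ` contains a tuple of conjugates of a point whose residue field is
`L`, for a suitable listing of the embeddings. -/
theorem exists_mem_closedPointsWithResidueField [Infinite k] [LocallyOfFiniteType f]
    [FiniteDimensional k L] [Algebra.IsSeparable k L] {d : ℕ} (hd : Module.finrank k L = d)
    (hX : d = 1 ∨ 0 < topologicalKrullDim X)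
    (hL : IsUnirational (pullback.snd f (specHom (algebraMap k L)))) (W : (power f d).Opens)
    (w : power f d) (hw : w ∈ W) :
    ∃ w' ∈ W, (toSym f d).base w' ∈ closedPointsWithResidueField f L d := by
  have hd0 : 0 < d := hd ▸ Module.finrank_pos
  obtain ⟨K, hK, P, hP⟩ := exists_field_point w
  let F := AlgebraicClosure K
  let P' : Spec (.of F) ⟶ power f d := specHom (algebraMap K F) ≫ P
  have hP' : P' (specPt F) = w := by
    rw [Scheme.Hom.comp_apply, ← hP]
    exact congrArg P (Subsingleton.elim _ _)
  -- The point `w` need not be algebraic over k, hence the larger field F; its k-structure is the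
  -- one carried by the point.
  obtain ⟨κ, hκ⟩ := specHom_surjective (P' ≫ WidePullback.base _)
  let : Algebra k F := κ.toAlgebra
  have : Infinite F := Infinite.of_injective _ (algebraMap k F).injective
  have hz (i) : (P' ≫ WidePullback.π (fun _ : Fin d => f) i) ≫ f = specHom (algebraMap k F) := by
    rw [Category.assoc, WidePullback.π_arrow]
    exact hκ
  have hzW : tuplePoint f _ hz ∈ W := by
    have h1 : (WidePullback.lift (specHom (algebraMap k F)) _ hz : Spec (.of F) ⟶ power f d) =
        P' := by
      apply WidePullback.hom_ext
      · intro i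
        rw [WidePullback.lift_π]
      · rw [WidePullback.lift_base, hκ]
    rwa [tuplePoint, h1, hP']
  let σ : Fin d ≃ (L →ₐ[k] AlgebraicClosure k) :=
    (Fintype.equivFinOfCardEq ((AlgHom.card k L (AlgebraicClosure k)).trans hd)).symm
  let ι : AlgebraicClosure k →ₐ[k] F := IsAlgClosed.lift
  let τ : Fin d → L →ₐ[k] F := fun i => ι.comp (σ i)
  have hτ : Function.Injective τ := fun i j hij => σ.injective (AlgHom.ext fun l =>
    ι.injective (DFunLike.congr_fun hij l))
  obtain ⟨V, hV, hxV, -⟩ := exists_isAffineOpen_mem_and_subset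
    (x := WidePullback.π (fun _ : Fin d => f) ⟨0, hd0⟩ w) (U := ⊤) trivial
  obtain ⟨n, h, y, hy, hh, hdom, hyV⟩ := exists_parametrization f hL V ⟨_, hxV⟩
  obtain ⟨ψ, hψ⟩ := specHom_surjective (R := Γ(X, V))
    (IsOpenImmersion.lift hV.fromSpec y (by rwa [hV.range_fromSpec]))
  have hψy : specHom ψ ≫ hV.fromSpec = y := by
    rw [← hψ]
    exact IsOpenImmersion.lift_fac _ _ _
  obtain ⟨b, hb⟩ : ∃ b : Γ(X, V),
      d = 1 ∨ ψ b ∉ Set.range (algebraMap L (Localization.Away h)) := by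
    rcases hX with hX | hX
    · exact ⟨0, Or.inl hX⟩
    · obtain ⟨b, hb⟩ := exists_nonconstant f hX hh y hy hdom hV ψ hψy
      exact ⟨b, Or.inr hb⟩
  obtain ⟨c, hc, hcW, hinj⟩ := exists_param_tuple_mem f hh y hy hdom τ W _ hz hzW (ψ b) hb
  obtain ⟨a, ha, hza, haW, hainj⟩ := exists_conjugate_tuple_mem f hd0
    (Module.finBasisOfFinrankEq k L hd) τ hτ y hy W (ψ b) c hc hcW hinj
  let ε : Localization.Away h →+* L := evalAway (RingHom.id L) a ha
  let p : Spec (.of L) ⟶ X := specHom (ε.comp ψ) ≫ hV.fromSpec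
  have hεy : specHom ε ≫ y = p := by rw [← hψy, ← Category.assoc, ← specHom_comp]
  have hp : p ≫ f = specHom (algebraMap k L) := by
    rw [← hεy, Category.assoc, hy, ← Category.assoc, ← specHom_comp, evalAway_comp_algebraMap,
      specHom_id, Category.id_comp]
  -- An element of a finite separable extension is primitive once it separates the embeddings into
  -- an algebraic closure.
  have hgen : IntermediateField.adjoin k {(ε.comp ψ) b} = ⊤ := by
    rw [Field.primitive_element_iff_algHom_eq_of_eval' k (AlgebraicClosure k)
      (fun x => IsAlgClosed.splits _)]
    intro φ₁ φ₂ h12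
    obtain ⟨i, rfl⟩ := σ.surjective φ₁
    obtain ⟨j, rfl⟩ := σ.surjective φ₂
    exact congrArg σ (hainj (congrArg ι h12))
  obtain ⟨x, iso, hx, hiso⟩ := exists_residueIso f hV (ε.comp ψ) hp b hgen
  have hfun : (fun i => specHom ((τ i : L →+* F).comp ε) ≫ y) = fun i =>
      specHom ((ι : AlgebraicClosure k →+* F).comp (σ i : L →+* AlgebraicClosure k)) ≫ p := by
    funext i
    rw [← hεy, specHom_comp, Category.assoc]
    rfl
  have hz' (i) : (specHom ((ι : AlgebraicClosure k →+* F).comp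
      (σ i : L →+* AlgebraicClosure k)) ≫ p) ≫ f = specHom (algebraMap k F) := by
    rw [← congrFun hfun i]
    exact hza i
  refine ⟨tuplePoint f _ hz', ?_, ?_⟩
  · convert haW using 2
    exact hfun.symm
  · exact mem_closedPointsWithResidueField_of_tuple f σ ι p hp x iso hx hiso hz'

end Density

end SymDensity

end

theorem mainTheorem6 {k : Type u} [Field k] [Infinite k]
    {X : Scheme.{u}} (f : X ⟶ Spec (.of k)) [Smooth f] [LocallyOfFiniteType f] [QuasiCompact f]
    [IrreducibleSpace X]
    {L : Type u} [Field L] [Algebra k L] [FiniteDimensional k L] [Algebra.IsSeparable k L]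
    (d : ℕ) (hd : Module.finrank k L = d)
    (hX : d = 1 ∨ 0 < topologicalKrullDim X)
    (hL : SymDensity.IsUnirational
      (pullback.snd f (Spec.map (CommRingCat.ofHom (algebraMap k L))))) :
    Dense (SymDensity.closedPointsWithResidueField f L d) := by
  rw [dense_iff_inter_open]
  intro O hO ⟨s, hs⟩
  obtain ⟨w, rfl⟩ := SymDensity.toSym_surjective f d s
  let W : (SymDensity.power f d).Opens :=
    ⟨(SymDensity.toSym f d).base ⁻¹' O, hO.preimage (SymDensity.toSym f d).base.hom.continuous⟩
  obtain ⟨w', hw', hmem⟩ :=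
    SymDensity.exists_mem_closedPointsWithResidueField f hd hX hL W w hs
  exact ⟨_, hw', hmem⟩
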